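/- Let $\mathcal V$ be a finite set and $\mathcal E\subset 2^{\mathcal V}$ a set of hyperedges containing $\emptyset$ and all singletons $\{s\}$. Let $f=(f_C)_{C\in\mathcal E}$ be a pseudo-Boolean energy with terms $f_C\colon\{0,1\}^C\to\mathbb R$, and write $E_f(x)=\sum_{C\in\mathcal E}f_C(x_C)$. Let $f'=(f'_C)_{C\in\mathcal E}$ be a sum-of-bisubmodular-functions (SoB) relaxation of $f$ over the same hypergraph: each $f'_C\colon\{0,\frac12,1\}^C\to\mathbb R$ is an extension of $f_C$ and is bisubmodular, i.e. $f'_C(x\sqcap y)+f'_C(x\sqcup y)\le f'_C(x)+f'_C(y)$ for all $x,y$. Here $\sqcap,\sqcup$ act coordinate-wise, with $a\sqcap a=a\sqcup a=a$, $a\sqcap\frac12=\frac12\sqcap a=\frac12$, $a\sqcup\frac12=\frac12\sqcup a=a$, and $0\sqcap1=1\sqcap0=0\sqcup1=1\sqcup0=\frac12$. Let $x^*\in\{0,\frac12,1\}^{\mathcal V}$ be any minimizer of $E_{f'}$, and let $p$ be the corresponding node-wise persistency mapping on $\{0,1\}^{\mathcal V}$: $p_s(i)=x^*_s$ if $x^*_s\ne\frac12$,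 and $p_s(i)=i$ if $x^*_s=\frac12$. Let the BLP polytope $\Lambda$ be the set of all $\mu=(\mu_C(x_C))_{C\in\mathcal E,\,x_C\in\{0,1\}^C}$ with $\mu\ge0$, $\mu_\emptyset=1$ and $\sum_{x_{C\setminus D}}\mu_C(x_C)=\mu_D(x_D)$ for all $C,D\in\mathcal E$ with $D\subsetneq C$, $|D|\le1$, and all $x_D$. For a node-wise mapping $q$ let $[q]$ be the linear map $([q]\mu)_C(x_C)=\sum_{x'_C:\,q_C(x'_C)=x_C}\mu_C(x'_C)$. Call $q$ BLP-improving for $f$ if $\langle f,[q]\mu\rangle\le\langle f,\mu\rangle$ for all $\mu\in\Lambda$, and strictly BLP-improving for $f$ if $\langle f,[q]\mu\rangle<\langle f,\mu\rangle$ for all $\mu\in\Lambda$ with $[q]\mu\ne\mu$. Say that $q$ eliminates the label $(s,i)$ if $q_s(i)\ne i$. The maximum persistency problem is to maximize the number of eliminated labels over all idempotent node-wise BLP-improving mappings for $f$; its strict variant maximizes over all idempotent node-wise strictly BLP-improving mappings for $f$. Then: 1. $p$ is idempotent and BLP-improving for $f$. 2. Hence it is dominated by the maximum persistency: the maximum persistency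 problem has a solution, and every solution $q$ of it eliminates at least as many labels as $p$ and satisfies $q_s\ne\mathrm{id}$ at every node $s$ with $x^*_s\ne\frac12$. 3. If moreover the persistency is strong, i.e. every minimizer $y$ of $E_{f'}$ has $y_s=x^*_s$ at each node $s$ with $x^*_s\neq\frac12$, then $p$ is strictly BLP-improving for $f$, the strict maximum persistency problem has a solution, and every solution of it eliminates every label that $p$ eliminates. -/

import Mathlib

namespace Persistency

/-- A hypergraph on the node set `V` whose hyperedges include `∅` and all singletons. -/
structure EnergyHypergraph (V : Type*) [DecidableEq V] where
  edges : Finset (Finset V)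
  empty_mem : ∅ ∈ edges
  singleton_mem : ∀ s : V, {s} ∈ edges

section General

variable {V : Type*} [DecidableEq V]

/-- Labelings of the nodes of `c` with labels in `L`. -/
abbrev LocalLabeling (L : Type*) (c : Finset V) : Type _ := {s // s ∈ c} → L

/-- The space `ℝ^I`, where `I` is the set of pairs `(c, x_c)` of a hyperedge `c` and a labeling
`x_c` of its nodes. Both cost vectors (families of terms `f_c`) and relaxed labelings `μ` are
elements of this space. -/
abbrev HVector (H : EnergyHypergraph V) (L : Type*) : Type _ :=
  (c : {c // c ∈ H.edges}) → LocalLabeling L c.1 → ℝ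

/-- The restriction of a labeling of all nodes to `c`. -/
def restrict {L : Type*} (x : V → L) (c : Finset V) : LocalLabeling L c := fun s => x s.1

/-- The restriction of a labeling of `c` to a subset `d` of `c`. -/
def restrictLocal {L : Type*} {d c : Finset V} (h : d ⊆ c) (x : LocalLabeling L c) :
    LocalLabeling L d := fun s => x ⟨s.1, h s.2⟩

/-- The energy `E_f(x) = ∑_c f_c(x_c)`. -/
def energy {H : EnergyHypergraph V} {L : Type*} (f : HVector H L) (x : V → L) : ℝ :=
  ∑ c : {c // c ∈ H.edges}, f c (restrict x c.1)

/-- `x` is a global minimizer of the energy `E_f`. -/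
def IsMinimizer {H : EnergyHypergraph V} {L : Type*} (f : HVector H L) (x : V → L) : Prop :=
  ∀ y : V → L, energy f x ≤ energy f y

/-- The scalar product of `ℝ^I`. -/
def scalarProd {H : EnergyHypergraph V} {L : Type*} [Fintype L] (f μ : HVector H L) : ℝ :=
  ∑ c : {c // c ∈ H.edges}, ∑ x : LocalLabeling L c.1, f c x * μ c x

/-- The local polytope of order `d`: relaxed labelings that satisfy the marginalization constraints
from `c` to `a` for all hyperedges `a ⊊ c` with `|a| ≤ d`. -/
def localPolytope (H : EnergyHypergraph V) (L : Type*) [Fintype L] [DecidableEq L] (d : ℕ) :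
    Set (HVector H L) :=
  {μ | (∀ (a c : {c // c ∈ H.edges}) (h : a.1 ⊂ c.1), a.1.card ≤ d →
          ∀ xa : LocalLabeling L a.1,
            ∑ x : LocalLabeling L c.1 with restrictLocal h.subset x = xa, μ c x = μ a xa) ∧
       (∀ x : LocalLabeling L (∅ : Finset V), μ ⟨∅, H.empty_mem⟩ x = 1) ∧
       (∀ c x, 0 ≤ μ c x)}

/-- The polytope of the basic LP relaxation (BLP): the local polytope of order `1`. -/
def BLP (H : EnergyHypergraph V) (L : Type*) [Fintype L] [DecidableEq L] : Set (HVector H L) :=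
  localPolytope H L 1

/-- The linear extension `[p]` of the node-wise mapping `x ↦ (p_s(x_s))_s`:
`([p] μ)_c(x_c) = ∑_{x'_c} [p_c(x'_c) = x_c] μ_c(x'_c)`. -/
def linExt {H : EnergyHypergraph V} {L : Type*} [Fintype L] [DecidableEq L] (p : V → L → L) :
    HVector H L →ₗ[ℝ] HVector H L where
  toFun μ := fun c x =>
    ∑ x' : LocalLabeling L c.1, (if (fun s => p s.1 (x' s)) = x then 1 else 0) * μ c x'
  map_add' μ ν := by
    funext c x
    simp [mul_add, Finset.sum_add_distrib]
  map_smul' r μ := by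
    funext c x
    simp [Finset.mul_sum]

/-- The linear map `P` is (weakly) `Λ`-improving for `f`. -/
def IsImproving {H : EnergyHypergraph V} {L : Type*} [Fintype L] (Λ : Set (HVector H L))
    (f : HVector H L) (P : HVector H L →ₗ[ℝ] HVector H L) : Prop :=
  ∀ μ ∈ Λ, scalarProd f (P μ) ≤ scalarProd f μ

/-- The linear map `P` is strictly `Λ`-improving for `f`. -/
def IsStrictlyImproving {H : EnergyHypergraph V} {L : Type*} [Fintype L] (Λ : Set (HVector H L))
    (f : HVector H L) (P : HVector H L →ₗ[ℝ] HVector H L) : Prop :=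
  ∀ μ ∈ Λ, P μ ≠ μ → scalarProd f (P μ) < scalarProd f μ

/-- The node-wise mapping given by `p` is idempotent. -/
def IsIdempotentMap {L : Type*} (p : V → L → L) : Prop := ∀ s i, p s (p s i) = p s i

/-- The idempotent node-wise mappings `p` such that `[p]` is `Λ`-improving for `f`. -/
def improvingMaps {H : EnergyHypergraph V} {L : Type*} [Fintype L] [DecidableEq L]
    (Λ : Set (HVector H L)) (f : HVector H L) : Set (V → L → L) :=
  {p | IsIdempotentMap p ∧ IsImproving Λ f (linExt p)}

/-- The idempotent node-wise mappings `p` such that `[p]` is strictly `Λ`-improving for `f`. -/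
def strictlyImprovingMaps {H : EnergyHypergraph V} {L : Type*} [Fintype L] [DecidableEq L]
    (Λ : Set (HVector H L)) (f : HVector H L) : Set (V → L → L) :=
  {p | IsIdempotentMap p ∧ IsStrictlyImproving Λ f (linExt p)}

/-- The set of labels `(s, i)` eliminated by `p`, that is, those with `p_s(i) ≠ i`. -/
def eliminated [Fintype V] {L : Type*} [Fintype L] [DecidableEq L] (p : V → L → L) :
    Finset (V × L) :=
  Finset.univ.filter fun a => p a.1 a.2 ≠ a.2

/-- `q` solves the maximum persistency problem over the set `S` of mappings: it lies in `S` and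
eliminates the maximal number of labels. -/
def IsMaxPersistency [Fintype V] {L : Type*} [Fintype L] [DecidableEq L] (S : Set (V → L → L))
    (q : V → L → L) : Prop :=
  q ∈ S ∧ ∀ r ∈ S, (eliminated r).card ≤ (eliminated q).card

end General

/-- The label set `{0, 1/2, 1}`. -/
inductive HalfLabel : Type
  | zero : HalfLabel
  | half : HalfLabel
  | one : HalfLabel
  deriving DecidableEq

namespace HalfLabel

/-- The operation `⊓` on `{0, 1/2, 1}`. -/
def meet : HalfLabel → HalfLabel → HalfLabel
  | zero, zero => zero
  | zero, half => half
  | zero, one => half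
  | half, zero => half
  | half, half => half
  | half, one => half
  | one, zero => half
  | one, half => half
  | one, one => one

/-- The operation `⊔` on `{0, 1/2, 1}`. -/
def join : HalfLabel → HalfLabel → HalfLabel
  | zero, zero => zero
  | zero, half => zero
  | zero, one => half
  | half, zero => zero
  | half, half => half
  | half, one => one
  | one, zero => half
  | one, half => one
  | one, one => one

/-- The inclusion `{0, 1} ⊆ {0, 1/2, 1}`, where `false` is `0` and `true` is `1`. -/
def ofBool : Bool → HalfLabel
  | false => zero
  | true => one

end HalfLabel

/-- Bisubmodularity of a function on `{0, 1/2, 1}^ι`. -/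
def IsBisubmodular {ι : Type*} (g : (ι → HalfLabel) → ℝ) : Prop :=
  ∀ x y : ι → HalfLabel,
    g (fun s => (x s).meet (y s)) + g (fun s => (x s).join (y s)) ≤ g x + g y

/-- `f'` is a sum-of-bisubmodular-functions relaxation of the pseudo-Boolean problem `f`, over the
same hypergraph: every term of `f'` is bisubmodular and extends the corresponding term of `f`. -/
def IsSoBRelaxation {V : Type*} [DecidableEq V] {H : EnergyHypergraph V}
    (f' : HVector H HalfLabel) (f : HVector H Bool) : Prop :=
  ∀ c, IsBisubmodular (f' c) ∧
    ∀ x : LocalLabeling Bool c.1, f' c (fun s => HalfLabel.ofBool (x s)) = f c x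

/-- The node-wise mapping given by the persistency of a labeling `y` in `{0, 1/2, 1}^V`: overwrite
the label of `s` with `y_s` where `y_s` is integral, keep it where `y_s = 1/2`. -/
def persistencyMap {V : Type*} (y : V → HalfLabel) : V → Bool → Bool := fun s i =>
  match y s with
  | HalfLabel.zero => false
  | HalfLabel.half => i
  | HalfLabel.one => true

end Persistency

/-! Integrated against a feasible `μ`, bisubmodularity becomes an inequality between relaxed
energies. Joining a Boolean label twice with `xs` gives exactly `persistencyMap xs`. Each join
leaves a meet term, which costs at least `energy f' xs` because BLP is tight for sums of
bisubmodular functions; hence the mapping is improving.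

Tightness (`affine_le_scalarProd`): order the nodes by decreasing absolute mean. Each term lies
above its affine interpolant on the resulting chain (`IsBisubmodular.affine_le`), and by feasibility
the integrated interpolants depend only on the node means. Their sum is a convex combination of
energies along the chain. Affine rather than constant lower bounds also force optimal relaxed
labelings to obey strong persistency, which gives strictness.

Domination: Boolean idempotents compose, so a solution `q` that is the identity where `p` is not
could be improved to `q ∘ p`. In the strict case both maps fix a minimizer of `f`, which decides
which label goes. -/

namespace Persistency

/-! ### Relaxed labelings under node-wise maps -/

section Pushforward

variable {V : Type*} [DecidableEq V] {H : EnergyHypergraph V}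
variable {L : Type*} [Fintype L] {L' : Type*} [Fintype L'] [DecidableEq L']

/-- The image of a relaxed labeling under a node-wise mapping between two label sets. -/
def pushforward (φ : V → L → L') (μ : HVector H L) : HVector H L' := fun c x =>
  ∑ x' : LocalLabeling L c.1, (if (fun s => φ s.1 (x' s)) = x then 1 else 0) * μ c x'

theorem linExt_apply [DecidableEq L] (p : V → L → L) (μ : HVector H L) : linExt p μ = pushforward p μ := rfl

theorem sum_mul_pushforward (φ : V → L → L') (μ : HVector H L) (c : {c // c ∈ H.edges})
    (g : LocalLabeling L' c.1 → ℝ) :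
    ∑ x, g x * pushforward φ μ c x = ∑ x, g (fun s => φ s.1 (x s)) * μ c x := by
  simp only [pushforward, Finset.mul_sum]
  rw [Finset.sum_comm]
  refine Finset.sum_congr rfl fun x' _ => ?_
  simp

theorem scalarProd_pushforward (φ : V → L → L') (μ : HVector H L) (f : HVector H L') :
    scalarProd f (pushforward φ μ) = ∑ c, ∑ x, f c (fun s => φ s.1 (x s)) * μ c x :=
  Finset.sum_congr rfl fun c _ => sum_mul_pushforward φ μ c (f c)

theorem pushforward_pushforward {L'' : Type*} [DecidableEq L''] (ψ : V → L' → L'') (φ : V → L → L') (μ : HVector H L) :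
    pushforward ψ (pushforward φ μ) = pushforward (fun s i => ψ s (φ s i)) μ := by
  funext c x
  exact sum_mul_pushforward φ μ c fun y => if (fun s => ψ s.1 (y s)) = x then 1 else 0

variable [DecidableEq L]

/-- Marginalization commutes with node-wise maps. The label sets may differ, so Boolean relaxed
labelings can be moved to `HalfLabel`. -/
theorem pushforward_mem_BLP (φ : V → L → L') {μ : HVector H L} (hμ : μ ∈ BLP H L) :
    pushforward φ μ ∈ BLP H L' := by
  obtain ⟨h1, h2, h3⟩ := hμ
  refine ⟨fun a c h ha xa => ?_, fun x => ?_, fun c x => ?_⟩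
  · have e1 := sum_mul_pushforward φ μ c fun x => if restrictLocal h.subset x = xa then 1 else 0
    simp only [ite_mul, one_mul, zero_mul, ← Finset.sum_filter] at e1
    rw [e1, pushforward]
    simp_rw [← h1 a c h ha, Finset.mul_sum, Finset.sum_filter]
    rw [Finset.sum_comm]
    refine Finset.sum_congr rfl fun x _ => ?_
    simp only [Finset.sum_ite_eq, Finset.mem_univ, if_true, ite_mul, one_mul, zero_mul]
    rfl
  · have e : ∀ y : LocalLabeling L (∅ : Finset V), (fun s => φ s.1 (y s)) = x := fun y => by
      funext s
      exact absurd s.2 (Finset.notMem_empty _)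
    simp [pushforward, e, h2]
  · exact Finset.sum_nonneg fun x' _ => mul_nonneg (by split_ifs <;> norm_num) (h3 c x')

/-- The relaxed labeling that represents the labeling `x`. -/
def dirac (x : V → L) : HVector H L := pushforward (fun s (_ : Unit) => x s) fun _ _ => 1

theorem one_mem_BLP : (fun _ _ => 1 : HVector H Unit) ∈ BLP H Unit := by
  refine ⟨fun a c h _ xa => ?_, fun _ => rfl, fun _ _ => zero_le_one⟩
  have e : ∀ x : LocalLabeling Unit c.1, restrictLocal h.subset x = xa := fun x => rfl
  simp [e]

theorem dirac_mem_BLP (x : V → L) : (dirac x : HVector H L) ∈ BLP H L :=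
  pushforward_mem_BLP _ one_mem_BLP

theorem linExt_dirac (p : V → L → L) (x : V → L) :
    linExt p (dirac x : HVector H L) = dirac fun s => p s (x s) :=
  pushforward_pushforward _ _ _

theorem scalarProd_dirac (f : HVector H L) (x : V → L) : scalarProd f (dirac x) = energy f x := by
  rw [dirac, scalarProd_pushforward]
  simp [energy]
  rfl

theorem dirac_injective : Function.Injective (dirac : (V → L) → HVector H L) := by
  intro x y h
  funext s
  have e := fun z : V → L => sum_mul_pushforward (H := H) (fun s (_ : Unit) => z s) (fun _ _ => 1)
    ⟨{s}, H.singleton_mem s⟩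
    fun u => if u ⟨s, Finset.mem_singleton_self s⟩ = x s then 1 else 0
  have e' := (e x).symm.trans ((congrArg (fun μ : HVector H L =>
    ∑ u, (if u ⟨s, Finset.mem_singleton_self s⟩ = x s then 1 else 0) *
      μ ⟨{s}, H.singleton_mem s⟩ u) h).trans (e y))
  by_contra hne
  simp [Ne.symm hne] at e'

theorem sum_apply_eq_of_mem_BLP {μ : HVector H L} (hμ : μ ∈ BLP H L) (c : {c // c ∈ H.edges})
    (s : V) (hs : s ∈ c.1) (h : L → ℝ) :
    ∑ x, h (x ⟨s, hs⟩) * μ c x =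
      ∑ x, h (x ⟨s, Finset.mem_singleton_self s⟩) * μ ⟨{s}, H.singleton_mem s⟩ x := by
  obtain ⟨c, hc⟩ := c
  by_cases hcs : c = {s}
  · subst hcs
    rfl
  have hss : ({s} : Finset V) ⊂ c :=
    (Finset.singleton_subset_iff.2 hs).ssubset_of_ne (Ne.symm hcs)
  simp_rw [← hμ.1 ⟨{s}, H.singleton_mem s⟩ ⟨c, hc⟩ hss (by simp), Finset.mul_sum,
    Finset.sum_filter]
  rw [Finset.sum_comm]
  refine Finset.sum_congr rfl fun x _ => ?_
  simp [restrictLocal]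

theorem sum_eq_one_of_mem_BLP {μ : HVector H L} (hμ : μ ∈ BLP H L) (c : {c // c ∈ H.edges}) :
    ∑ x, μ c x = 1 := by
  obtain ⟨c, hc⟩ := c
  by_cases hce : c = ∅
  · subst hce
    simp [hμ.2.1]
  have hss : (∅ : Finset V) ⊂ c := Finset.empty_ssubset.2 (Finset.nonempty_iff_ne_empty.2 hce)
  have x0 : LocalLabeling L (∅ : Finset V) := fun s => absurd s.2 (Finset.notMem_empty _)
  have e : ∀ x : LocalLabeling L c, restrictLocal hss.subset x = x0 := fun x => by
    funext s
    exact absurd s.2 (Finset.notMem_empty _)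
  have := hμ.1 ⟨∅, H.empty_mem⟩ ⟨c, hc⟩ hss (by simp) x0
  simpa [e, hμ.2.1] using this

end Pushforward

/-! ### Sign arithmetic of the half-integral labels -/

namespace HalfLabel

instance : Fintype HalfLabel := ⟨{zero, half, one}, fun a => by cases a <;> simp⟩

/-- The labels `0, 1/2, 1`, rescaled to `-1, 0, 1`. -/
def sign : HalfLabel → ℝ
  | zero => -1
  | half => 0
  | one => 1

@[simp] theorem sign_half : sign half = 0 := rfl

theorem sign_meet_add_sign_join (a b : HalfLabel) :
    (a.meet b).sign + (a.join b).sign = a.sign + b.sign := by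
  cases a <;> cases b <;> norm_num [sign, meet, join]

theorem sign_mul_self {a : HalfLabel} (ha : a ≠ half) : a.sign * a.sign = 1 := by
  cases a <;> simp_all [sign]

theorem half_join (a : HalfLabel) : half.join a = a := by cases a <;> rfl

theorem join_self (a : HalfLabel) : a.join a = a := by cases a <;> rfl

theorem meet_eq_half_or_eq (a b : HalfLabel) : a.meet b = half ∨ a.meet b = b := by
  cases a <;> cases b <;> simp [meet]

theorem join_eq_half_or_eq (a : HalfLabel) {b : HalfLabel} (hb : b ≠ half) :
    a.join b = half ∨ a.join b = b := by
  cases a <;> cases b <;> simp_all [join]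

theorem abs_sign_le_one (a : HalfLabel) : |a.sign| ≤ 1 := by
  cases a <;> simp [sign]

theorem sign_mul_sign_le_one (a b : HalfLabel) : a.sign * b.sign ≤ 1 := by
  cases a <;> cases b <;> norm_num [sign]

end HalfLabel

open HalfLabel

/-! ### Affine minorants of bisubmodular functions -/

section Greedy

/-- The `k`-th member of the chain of labelings that starts at `1/2` and switches the coordinates to
the values of `σ` in the order given by `r`. -/
def chain {ι : Type*} (r : ι → ℕ) (σ : ι → HalfLabel) (k : ℕ) : ι → HalfLabel :=
  fun s => if r s < k then σ s else half

theorem chain_succ_eq {ι : Type*} {r : ι → ℕ} {k : ℕ} (hk : ∀ s, r s ≠ k) (σ : ι → HalfLabel) :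
    chain r σ (k + 1) = chain r σ k := by
  funext s
  have : r s < k + 1 ↔ r s < k := by have := hk s; omega
  simp [chain, this]

variable {ι : Type*} [Fintype ι]

theorem sum_mul_sign_chain_succ {r : ι → ℕ} (hr : Function.Injective r) (σ : ι → HalfLabel)
    (a : ι → ℝ) (s : ι) :
    ∑ t, a t * (chain r σ (r s + 1) t).sign =
      ∑ t, a t * (chain r σ (r s) t).sign + a s * (σ s).sign := by
  classical
  rw [← sub_eq_iff_eq_add', ← Finset.sum_sub_distrib, Finset.sum_eq_single s]
  · simp [chain]
  · intro t _ hts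
    have h1 : r t ≠ r s := fun h => hts (hr h)
    have h2 : r t < r s + 1 ↔ r t < r s := by omega
    simp [chain, h2]
  · simp

theorem IsBisubmodular.sub_affine {g : (ι → HalfLabel) → ℝ} (hg : IsBisubmodular g) (b : ℝ)
    (a : ι → ℝ) : IsBisubmodular fun y => g y - (b + ∑ s, a s * (y s).sign) := by
  intro x y
  have e : ∑ s, a s * ((x s).meet (y s)).sign + ∑ s, a s * ((x s).join (y s)).sign =
      ∑ s, a s * (x s).sign + ∑ s, a s * (y s).sign := by
    simp only [← Finset.sum_add_distrib, ← mul_add, sign_meet_add_sign_join]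
  have := hg x y
  simp only
  linarith

/-- Induction on the chain: if `y` agrees with `σ` on its support within the first `k + 1` ranks and
uses rank `k`, its join with chain member `k` is member `k + 1`, and its meet drops rank `k`. A
general `y` is then compared with `σ`. -/
theorem IsBisubmodular.nonneg_of_chain {h : (ι → HalfLabel) → ℝ} (hh : IsBisubmodular h)
    {r : ι → ℕ} (hr : Function.Injective r) {σ : ι → HalfLabel} (hσ : ∀ s, σ s ≠ half)
    (hc : ∀ k, h (chain r σ k) = 0) (y : ι → HalfLabel) : 0 ≤ h y := by
  have key : ∀ k (y : ι → HalfLabel), (∀ s, y s = half ∨ y s = σ s ∧ r s < k) → 0 ≤ h y := by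
    intro k
    induction k with
    | zero =>
      intro y hy
      have : y = chain r σ 0 := by
        funext s
        simpa [chain] using hy s
      rw [this, hc]
    | succ k ih =>
      intro y hy
      by_cases hs : ∃ s, r s = k ∧ y s ≠ half
      · obtain ⟨s, hsk, hys⟩ := hs
        have h1 := hh y (chain r σ k)
        have h2 : (fun t => (y t).join (chain r σ k t)) = chain r σ (k + 1) := by
          funext t
          by_cases hts : t = s
          · subst hts
            have := hy t
            simp only [hys, false_or] at this
            rw [this.1]
            have := hσ t
            cases e : σ t <;> simp_all [chain, join]
          · have hne : r t ≠ k := fun e => hts (hr (e.trans hsk.symm))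
            have hiff : r t < k + 1 ↔ r t < k := by omega
            have := hσ t
            rcases hy t with e | ⟨e, e'⟩
            · simp only [chain, e, half_join, hiff]
            · rw [hiff] at e'
              simp [chain, e, e', hiff, join_self]
        have h3 : 0 ≤ h (fun t => (y t).meet (chain r σ k t)) := by
          refine ih _ fun t => ?_
          have := hσ t
          by_cases hk : r t < k
          · rcases hy t with e | ⟨e, e'⟩ <;> cases e2 : σ t <;> simp_all [chain, meet]
          · left
            cases e2 : y t <;> simp [chain, hk, meet]
        rw [h2, hc, hc] at h1
        linarith
      · push Not at hs
        refine ih y fun s => ?_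
        rcases hy s with e | ⟨e, e'⟩
        · exact Or.inl e
        · by_cases hk : r s = k
          · exact Or.inl (hs s hk)
          · exact Or.inr ⟨e, by omega⟩
  -- Ranks need not be consecutive; their sum plus one exceeds them all, so the chain has reached
  -- `σ` there.
  have hlt : ∀ s, r s < (∑ t, r t) + 1 := fun s =>
    Nat.lt_succ_of_le (Finset.single_le_sum (fun t _ => Nat.zero_le (r t)) (Finset.mem_univ s))
  have hN : σ = chain r σ ((∑ t, r t) + 1) := by
    funext s
    simp [chain, hlt s]
  have h1 := hh y σ
  have h2 := key _ (fun s => (y s).meet (σ s)) fun s => by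
    exact (meet_eq_half_or_eq (y s) (σ s)).imp_right fun e => ⟨e, hlt s⟩
  have h3 := key _ (fun s => (y s).join (σ s)) fun s => by
    exact (join_eq_half_or_eq (y s) (hσ s)).imp_right fun e => ⟨e, hlt s⟩
  have h4 : h σ = 0 := by rw [hN, hc]
  linarith

/-- The affine function that interpolates a bisubmodular function on a maximal chain is a lower
bound of it. -/
theorem IsBisubmodular.affine_le {g : (ι → HalfLabel) → ℝ} (hg : IsBisubmodular g)
    {r : ι → ℕ} (hr : Function.Injective r) {σ : ι → HalfLabel} (hσ : ∀ s, σ s ≠ half)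
    (y : ι → HalfLabel) :
    g (chain r σ 0) + ∑ s, ((σ s).sign * (g (chain r σ (r s + 1)) - g (chain r σ (r s)))) *
      (y s).sign ≤ g y := by
  refine sub_nonneg.1 ((hg.sub_affine _ _).nonneg_of_chain hr hσ (fun k => ?_) y)
  induction k with
  | zero => simp [chain]
  | succ k ih =>
    by_cases hk : ∃ s, r s = k
    · obtain ⟨s, rfl⟩ := hk
      rw [sum_mul_sign_chain_succ hr]
      have := sign_mul_self (hσ s)
      linear_combination ih - (g (chain r σ (r s + 1)) - g (chain r σ (r s))) * this
    · push Not at hk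
      rwa [chain_succ_eq hk]

end Greedy

/-- Summation by parts gives the `D k` nonnegative weights `1 - w 0`, `w (k - 1) - w k`, and the
last `w`. -/
theorem nonneg_add_sum_mul_sub {w D : ℕ → ℝ} (hw : Antitone w) (hw1 : w 0 ≤ 1) (hw0 : ∀ k, 0 ≤ w k)
    (hD : ∀ k, 0 ≤ D k) (n : ℕ) : 0 ≤ D 0 + ∑ k ∈ Finset.range n, w k * (D (k + 1) - D k) := by
  suffices h : w n * D n ≤ D 0 + ∑ k ∈ Finset.range n, w k * (D (k + 1) - D k) from
    (mul_nonneg (hw0 n) (hD n)).trans h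
  induction n with
  | zero => simpa using mul_le_of_le_one_left (hD 0) hw1
  | succ n ih =>
    rw [Finset.sum_range_succ]
    have := mul_le_mul_of_nonneg_right (hw (Nat.le_succ n)) (hD (n + 1))
    linarith

/-- An ordering of a finite type by a real function, in decreasing order. -/
theorem exists_antitone_order {V : Type*} [Fintype V] (z : V → ℝ) :
    ∃ e : V ≃ Fin (Fintype.card V), ∀ i j, i ≤ j → z (e.symm j) ≤ z (e.symm i) := by
  let e₀ := Fintype.equivFin V
  let τ := Tuple.sort fun i => -z (e₀.symm i)
  refine ⟨e₀.trans τ.symm, fun i j hij => ?_⟩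
  simpa using Tuple.monotone_sort (fun i => -z (e₀.symm i)) hij

/-! ### Tightness of BLP for sums of bisubmodular functions -/

section Tightness

variable {V : Type*} [DecidableEq V] {H : EnergyHypergraph V}

/-- The mean of a relaxed labeling at a node, for the labels `-1, 0, 1`. -/
def mean (ν : HVector H HalfLabel) (s : V) : ℝ :=
  ∑ x, (x ⟨s, Finset.mem_singleton_self s⟩).sign * ν ⟨{s}, H.singleton_mem s⟩ x

theorem abs_mean_le_one {ν : HVector H HalfLabel} (hν : ν ∈ BLP H HalfLabel) (s : V) :
    |mean ν s| ≤ 1 := by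
  rw [← sum_eq_one_of_mem_BLP hν ⟨{s}, H.singleton_mem s⟩]
  refine (Finset.abs_sum_le_sum_abs _ _).trans (Finset.sum_le_sum fun x _ => ?_)
  rw [abs_mul, abs_of_nonneg (hν.2.2 _ x)]
  exact mul_le_of_le_one_left (hν.2.2 _ x) (abs_sign_le_one _)

variable [Fintype V]

/-- One global chain restricts to a chain on every hyperedge, and the singleton constraints give all
hyperedges the same node means, so the local bounds add up. -/
theorem energy_affine_le {f' : HVector H HalfLabel} (hf' : ∀ c, IsBisubmodular (f' c))
    {ν : HVector H HalfLabel} (hν : ν ∈ BLP H HalfLabel) {r : V → ℕ} (hr : Function.Injective r)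
    {σ : V → HalfLabel} (hσ : ∀ s, σ s ≠ half) :
    energy f' (chain r σ 0) + ∑ s, (σ s).sign * mean ν s *
      (energy f' (chain r σ (r s + 1)) - energy f' (chain r σ (r s))) ≤ scalarProd f' ν := by
  have hc : ∀ c : {c // c ∈ H.edges}, f' c (restrict (chain r σ 0) c.1) +
      ∑ s, (σ s).sign * mean ν s * (f' c (restrict (chain r σ (r s + 1)) c.1) -
        f' c (restrict (chain r σ (r s)) c.1)) ≤ ∑ x, f' c x * ν c x := by
    intro c
    have hr' : Function.Injective fun s : {s // s ∈ c.1} => r s.1 := hr.comp Subtype.val_injective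
    have h1 := Finset.sum_le_sum fun x (_ : x ∈ Finset.univ) =>
      mul_le_mul_of_nonneg_right
        ((hf' c).affine_le hr' (σ := fun s => σ s.1) (fun s => hσ s.1) x) (hν.2.2 c x)
    refine le_of_eq_of_le ?_ h1
    simp only [add_mul, Finset.sum_add_distrib, ← Finset.mul_sum, sum_eq_one_of_mem_BLP hν c,
      mul_one, Finset.sum_mul]
    congr 1
    rw [Finset.sum_comm]
    have h2 : ∑ s, (σ s).sign * mean ν s * (f' c (restrict (chain r σ (r s + 1)) c.1) -
        f' c (restrict (chain r σ (r s)) c.1)) =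
        ∑ s ∈ c.1, (σ s).sign * mean ν s * (f' c (restrict (chain r σ (r s + 1)) c.1) -
        f' c (restrict (chain r σ (r s)) c.1)) := by
      -- Nodes outside `c` do not move the restricted chain.
      refine (Finset.sum_subset (Finset.subset_univ _) fun s _ hs => ?_).symm
      have : restrict (chain r σ (r s + 1)) c.1 = restrict (chain r σ (r s)) c.1 :=
        chain_succ_eq (r := fun t : {t // t ∈ c.1} => r t.1)
          (fun t ht => hs ((hr ht : t.1 = s) ▸ t.2)) fun t => σ t.1
      simp [this]
    rw [h2, ← Finset.sum_coe_sort c.1]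
    refine Finset.sum_congr rfl fun s _ => ?_
    rw [mean, ← sum_apply_eq_of_mem_BLP hν c s.1 s.2]
    rw [Finset.mul_sum, Finset.sum_mul]
    refine Finset.sum_congr rfl fun x _ => ?_
    have e : ∀ k, restrict (chain r σ k) c.1 = chain (fun s => r s.1) (fun s => σ s.1) k :=
      fun _ => rfl
    rw [e, e]
    ring
  refine le_of_eq_of_le ?_ (Finset.sum_le_sum fun c _ => hc c)
  simp only [energy, Finset.sum_add_distrib, ← Finset.sum_sub_distrib, Finset.mul_sum]
  congr 1
  exact Finset.sum_comm

/-- Tightness of the BLP relaxation for sums of bisubmodular functions: an affine lower bound of the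
energy is a lower bound of the relaxed energy. -/
theorem affine_le_scalarProd {f' : HVector H HalfLabel} (hf' : ∀ c, IsBisubmodular (f' c))
    {ν : HVector H HalfLabel} (hν : ν ∈ BLP H HalfLabel) (m : ℝ) (a : V → ℝ)
    (hm : ∀ y : V → HalfLabel, m + ∑ s, a s * (y s).sign ≤ energy f' y) :
    m + ∑ s, a s * mean ν s ≤ scalarProd f' ν := by
  obtain ⟨e, he⟩ := exists_antitone_order fun s => |mean ν s|
  let r : V → ℕ := fun s => e s
  have hr : Function.Injective r := Fin.val_injective.comp e.injective
  let σ : V → HalfLabel := fun s => if 0 ≤ mean ν s then one else zero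
  have hσ : ∀ s, σ s ≠ half := fun s => by
    simp only [σ]
    split_ifs <;> simp
  have habs : ∀ s, (σ s).sign * mean ν s = |mean ν s| := fun s => by
    simp only [σ]
    split_ifs with h
    · simp [sign, abs_of_nonneg h]
    · simp [sign, abs_of_neg (not_le.1 h)]
  -- The default `0` past the last node keeps `w` antitone and nonnegative on all of `ℕ`.
  let w : ℕ → ℝ := fun k => if h : k < Fintype.card V then |mean ν (e.symm ⟨k, h⟩)| else 0
  have hw0 : ∀ k, 0 ≤ w k := fun k => by
    simp only [w]
    split_ifs <;> positivity
  have hw : Antitone w := by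
    intro i j hij
    by_cases hj : j < Fintype.card V
    · simp only [w, hj, hij.trans_lt hj, dite_true]
      exact he _ _ hij
    · simpa [w, hj] using hw0 i
  have hw1 : w 0 ≤ 1 := by
    simp only [w]
    split_ifs
    · exact abs_mean_le_one hν _
    · exact zero_le_one
  let D : ℕ → ℝ := fun k =>
    energy f' (chain r σ k) - (m + ∑ s, a s * (chain r σ k s).sign)
  have h1 := nonneg_add_sum_mul_sub hw hw1 hw0 (D := D) (fun k => sub_nonneg.2 (hm _))
    (Fintype.card V)
  have h2 : ∑ k ∈ Finset.range (Fintype.card V), w k * (D (k + 1) - D k) =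
      ∑ s, |mean ν s| * (D (r s + 1) - D (r s)) := by
    rw [← Fin.sum_univ_eq_sum_range (fun k => w k * (D (k + 1) - D k)),
      ← Equiv.sum_comp e]
    refine Finset.sum_congr rfl fun s _ => ?_
    simp [w, r]
  have h3 : ∑ s, |mean ν s| * (D (r s + 1) - D (r s)) =
      ∑ s, (σ s).sign * mean ν s *
        (energy f' (chain r σ (r s + 1)) - energy f' (chain r σ (r s))) -
      ∑ s, a s * mean ν s := by
    rw [← Finset.sum_sub_distrib]
    refine Finset.sum_congr rfl fun s _ => ?_
    simp only [D]
    rw [sum_mul_sign_chain_succ hr, ← habs]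
    linear_combination (-(a s) * mean ν s) * HalfLabel.sign_mul_self (hσ s)
  have h4 : D 0 = energy f' (chain r σ 0) - m := by simp [D, chain]
  have h5 := energy_affine_le hf' hν hr hσ
  linarith

theorem IsMinimizer.energy_le_scalarProd {f' : HVector H HalfLabel} {xs : V → HalfLabel}
    (hxs : IsMinimizer f' xs) (hf' : ∀ c, IsBisubmodular (f' c)) {ν : HVector H HalfLabel}
    (hν : ν ∈ BLP H HalfLabel) : energy f' xs ≤ scalarProd f' ν := by
  simpa using affine_le_scalarProd hf' hν (energy f' xs) 0 fun y => by simpa using hxs y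

/-- A node at which all minimizers agree on an integral label has the same label in every optimal
relaxed labeling. -/
theorem one_le_sign_mul_mean {f' : HVector H HalfLabel} (hf' : ∀ c, IsBisubmodular (f' c))
    {xs : V → HalfLabel} (hxs : IsMinimizer f' xs) {s : V}
    (hs : ∀ y, IsMinimizer f' y → y s = xs s) (hhalf : xs s ≠ half)
    {ν : HVector H HalfLabel} (hν : ν ∈ BLP H HalfLabel)
    (hopt : scalarProd f' ν ≤ energy f' xs) : 1 ≤ (xs s).sign * mean ν s := by
  classical
  -- The penalty vanishes exactly when `y s = xs s` and is at most `2`, so half the energy gap of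
  -- each disagreeing labeling suffices; finiteness gives a common `ε`.
  obtain ⟨ε, hε, hb⟩ : ∃ ε > 0, ∀ y : V → HalfLabel,
      energy f' xs + ε * (1 - (xs s).sign * (y s).sign) ≤ energy f' y := by
    have hy : ∀ y : V → HalfLabel, ∃ ε > 0,
        energy f' xs + ε * (1 - (xs s).sign * (y s).sign) ≤ energy f' y := by
      intro y
      by_cases h : y s = xs s
      · refine ⟨1, one_pos, ?_⟩
        rw [h, sign_mul_self hhalf]
        simpa using hxs y
      · have hlt : energy f' xs < energy f' y := by
          refine lt_of_not_ge fun hle => h (hs y fun z => hle.trans (hxs z))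
        refine ⟨(energy f' y - energy f' xs) / 2, by linarith, ?_⟩
        have h2 : 1 - (xs s).sign * (y s).sign ≤ 2 := by
          cases xs s <;> cases y s <;> norm_num [sign]
        have := mul_le_mul_of_nonneg_left h2
          (show 0 ≤ (energy f' y - energy f' xs) / 2 by linarith)
        linarith
    choose ε hε hb using hy
    have : Nonempty HalfLabel := ⟨half⟩
    obtain ⟨y₀, hy₀⟩ := Finite.exists_min ε
    refine ⟨ε y₀, hε y₀, fun y => le_trans ?_ (hb y)⟩
    have := mul_le_mul_of_nonneg_right (hy₀ y)
      (sub_nonneg.2 (sign_mul_sign_le_one (xs s) (y s)))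
    linarith
  have h1 := affine_le_scalarProd hf' hν (energy f' xs + ε)
    (fun t => if t = s then -(ε * (xs s).sign) else 0) fun y => by
      have := hb y
      simp only [ite_mul, zero_mul, Finset.sum_ite_eq', Finset.mem_univ, if_true]
      linarith
  simp only [ite_mul, zero_mul, Finset.sum_ite_eq', Finset.mem_univ, if_true] at h1
  refine le_of_mul_le_mul_left ?_ hε
  linarith

end Tightness

/-! ### The persistency mapping is improving -/

section Improving

variable {V : Type*}

/-- The first join turns a disagreeing label into `half`; the second fills in `y s`. -/
theorem join_join_ofBool (y : V → HalfLabel) (s : V) (i : Bool) :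
    ((ofBool i).join (y s)).join (y s) = ofBool (persistencyMap y s i) := by
  cases h : y s <;> cases i <;> simp [persistencyMap, h, ofBool, join]

theorem isIdempotentMap_persistencyMap (y : V → HalfLabel) :
    IsIdempotentMap (persistencyMap y) := by
  intro s i
  cases h : y s <;> simp [persistencyMap, h]

theorem persistencyMap_ne_id {y : V → HalfLabel} {s : V} (h : y s ≠ half) :
    persistencyMap y s ≠ id := by
  intro e
  have h0 := congrFun e false
  have h1 := congrFun e true
  cases h' : y s <;> simp_all [persistencyMap]

variable [DecidableEq V] {H : EnergyHypergraph V}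

theorem scalarProd_meet_add_scalarProd_join_le {L : Type*} [Fintype L] [DecidableEq L]
    {f' : HVector H HalfLabel}
    (hf' : ∀ c, IsBisubmodular (f' c)) {μ : HVector H L} (hμ : μ ∈ BLP H L)
    (φ : V → L → HalfLabel) (x : V → HalfLabel) :
    scalarProd f' (pushforward (fun s i => (φ s i).meet (x s)) μ) +
      scalarProd f' (pushforward (fun s i => (φ s i).join (x s)) μ) ≤
    scalarProd f' (pushforward φ μ) + energy f' x := by
  simp only [scalarProd_pushforward, energy, ← Finset.sum_add_distrib]
  refine Finset.sum_le_sum fun c _ => ?_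
  have : f' c (restrict x c.1) = ∑ y, f' c (restrict x c.1) * μ c y := by
    rw [← Finset.mul_sum, sum_eq_one_of_mem_BLP hμ, mul_one]
  rw [this, ← Finset.sum_add_distrib]
  refine Finset.sum_le_sum fun y _ => ?_
  rw [← add_mul, ← add_mul]
  exact mul_le_mul_of_nonneg_right (hf' c _ _) (hμ.2.2 c y)

theorem IsSoBRelaxation.scalarProd_ofBool {f : HVector H Bool} {f' : HVector H HalfLabel}
    (hf' : IsSoBRelaxation f' f) (p : V → Bool → Bool) (μ : HVector H Bool) :
    scalarProd f' (pushforward (fun s i => ofBool (p s i)) μ) =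
      scalarProd f (pushforward p μ) := by
  simp only [scalarProd_pushforward]
  refine Finset.sum_congr rfl fun c _ => Finset.sum_congr rfl fun x _ => ?_
  rw [← (hf' c).2]

theorem pushforward_id {L : Type*} [Fintype L] [DecidableEq L] (μ : HVector H L) :
    pushforward (fun _ i => i) μ = μ := by
  funext c x
  simp [pushforward]

/-- Tightness absorbs the meet term of the second join. That of the first is kept, since the strict
case needs it to be optimal. -/
theorem scalarProd_linExt_persistencyMap_add_le [Fintype V] {f : HVector H Bool}
    {f' : HVector H HalfLabel}
    (hf' : IsSoBRelaxation f' f) {xs : V → HalfLabel} (hxs : IsMinimizer f' xs)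
    {μ : HVector H Bool} (hμ : μ ∈ BLP H Bool) :
    scalarProd f (linExt (persistencyMap xs) μ) +
      scalarProd f' (pushforward (fun s i => (ofBool i).meet (xs s)) μ) ≤
        scalarProd f μ + energy f' xs := by
  have hb := fun c => (hf' c).1
  have h1 := scalarProd_meet_add_scalarProd_join_le hb hμ (fun _ i => ofBool i) xs
  have h2 := scalarProd_meet_add_scalarProd_join_le hb hμ (fun s i => (ofBool i).join (xs s)) xs
  have h3 := hxs.energy_le_scalarProd hb
    (pushforward_mem_BLP (fun s i => ((ofBool i).join (xs s)).meet (xs s)) hμ)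
  simp only [join_join_ofBool] at h2
  rw [hf'.scalarProd_ofBool] at h2
  have h4 := hf'.scalarProd_ofBool (fun _ i => i) μ
  rw [pushforward_id] at h4
  rw [linExt_apply]
  linarith

theorem persistencyMap_mem_improvingMaps [Fintype V] {f : HVector H Bool}
    {f' : HVector H HalfLabel}
    (hf' : IsSoBRelaxation f' f) {xs : V → HalfLabel} (hxs : IsMinimizer f' xs) :
    persistencyMap xs ∈ improvingMaps (BLP H Bool) f := by
  refine ⟨isIdempotentMap_persistencyMap xs, fun μ hμ => ?_⟩
  have h1 := scalarProd_linExt_persistencyMap_add_le hf' hxs hμ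
  have h2 := hxs.energy_le_scalarProd (fun c => (hf' c).1)
    (pushforward_mem_BLP (fun s i => (ofBool i).meet (xs s)) hμ)
  linarith

theorem linExt_eq_self_of_support {L : Type*} [Fintype L] [DecidableEq L] {p : V → L → L}
    {μ : HVector H L} (h : ∀ c x, μ c x ≠ 0 → ∀ s : {s // s ∈ c.1}, p s.1 (x s) = x s) :
    linExt p μ = μ := by
  funext c x
  rw [linExt_apply]
  conv_rhs => rw [← pushforward_id μ]
  refine Finset.sum_congr rfl fun y _ => ?_
  by_cases hy : μ c y = 0
  · simp [hy]
  · simp only [h c y hy]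

theorem persistencyMap_mem_strictlyImprovingMaps [Fintype V] {f : HVector H Bool}
    {f' : HVector H HalfLabel} (hf' : IsSoBRelaxation f' f) {xs : V → HalfLabel}
    (hxs : IsMinimizer f' xs)
    (hstrong : ∀ y, IsMinimizer f' y → ∀ s, xs s ≠ half → y s = xs s) :
    persistencyMap xs ∈ strictlyImprovingMaps (BLP H Bool) f := by
  refine ⟨isIdempotentMap_persistencyMap xs, fun μ hμ hne => lt_of_not_ge fun hle => hne ?_⟩
  have hb := fun c => (hf' c).1
  have h1 := scalarProd_linExt_persistencyMap_add_le hf' hxs hμ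
  have hν := pushforward_mem_BLP (fun s i => (ofBool i).meet (xs s)) hμ
  refine linExt_eq_self_of_support fun c x hx s => ?_
  by_contra hps
  have hhalf : xs s.1 ≠ half := fun e => hps (by simp [persistencyMap, e])
  have h2 := one_le_sign_mul_mean hb hxs (fun y hy => hstrong y hy s.1 hhalf) hhalf hν
    (by linarith)
  -- The mean can be computed on `c`, where `x` has positive weight.
  have h3 : mean (pushforward (fun s i => (ofBool i).meet (xs s)) μ) s.1 =
      ∑ y, ((ofBool (y s)).meet (xs s.1)).sign * μ c y :=
    (sum_mul_pushforward (L' := HalfLabel) _ μ ⟨{s.1}, H.singleton_mem s.1⟩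
      fun x => (x ⟨s.1, Finset.mem_singleton_self s.1⟩).sign).trans
      (sum_apply_eq_of_mem_BLP hμ c s.1 s.2 fun i => ((ofBool i).meet (xs s.1)).sign).symm
  rw [h3, ← sum_eq_one_of_mem_BLP hμ c, Finset.mul_sum] at h2
  refine absurd h2 (not_le.2 (Finset.sum_lt_sum (fun y _ => ?_) ⟨x, Finset.mem_univ _, ?_⟩))
  · rw [← mul_assoc]
    exact mul_le_of_le_one_left (hμ.2.2 c y) (sign_mul_sign_le_one _ _)
  -- An eliminated label is opposite to `xs s`, so their meet is `half`, making the mean too small.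
  · have hzero : ((ofBool (x s)).meet (xs s.1)).sign = 0 := by
      cases e : xs s.1 <;> cases e' : x s <;> simp_all [persistencyMap, ofBool, meet]
    have hpos : 0 < μ c x := lt_of_le_of_ne (hμ.2.2 c x) (Ne.symm hx)
    simpa [hzero] using hpos

end Improving

/-! ### Composition and maximum persistency -/

section MaxPersistency

variable {V : Type*}

/-- Special to two labels: the idempotents are the identity and the constants. -/
theorem IsIdempotentMap.comp {p q : V → Bool → Bool} (hq : IsIdempotentMap q)
    (hp : IsIdempotentMap p) : IsIdempotentMap fun s i => q s (p s i) := by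
  have key : ∀ p q : Bool → Bool, (∀ i, q (q i) = q i) → (∀ i, p (p i) = p i) →
      ∀ i, q (p (q (p i))) = q (p i) := by decide
  exact fun s => key _ _ (hq s) (hp s)

/-- Labels eliminated by the idempotent `q` lie outside its image, so `q ∘ p` still eliminates them;
at `s` it would gain one. -/
theorem IsMaxPersistency.ne_id [Fintype V] {S : Set (V → Bool → Bool)} {p q : V → Bool → Bool}
    (hq : IsMaxPersistency S q) (hidem : IsIdempotentMap q)
    (hcomp : (fun s i => q s (p s i)) ∈ S) {s : V} (hs : p s ≠ id) : q s ≠ id := by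
  intro hid
  refine (hq.2 _ hcomp).not_gt (Finset.card_lt_card (Finset.ssubset_iff_subset_ne.2 ⟨?_, ?_⟩))
  · have key : ∀ p q : Bool → Bool, (∀ i, q (q i) = q i) → ∀ i, q i ≠ i → q (p i) ≠ i := by decide
    intro a ha
    simp only [eliminated, Finset.mem_filter, Finset.mem_univ, true_and] at ha ⊢
    exact key _ _ (hidem a.1) _ ha
  · intro e
    obtain ⟨i, hi⟩ := Function.ne_iff.1 hs
    have := congrArg ((s, i) ∈ ·) e
    simp [eliminated, hid] at this
    exact hi this

theorem exists_isMaxPersistency [Fintype V] {L : Type*} [Fintype L] [DecidableEq L]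
    {S : Set (V → L → L)} (hS : S.Nonempty) : ∃ q, IsMaxPersistency S q := by
  obtain ⟨q, hq, h⟩ := S.toFinite.exists_maximalFor (fun r => (eliminated r).card) S hS
  exact ⟨q, hq, fun r hr => (le_total _ _).elim id fun hle => h hr hle⟩

variable [DecidableEq V] {H : EnergyHypergraph V}

theorem linExt_comp {L : Type*} [Fintype L] [DecidableEq L] (q p : V → L → L) (μ : HVector H L) :
    linExt (fun s i => q s (p s i)) μ = linExt q (linExt p μ) :=
  (pushforward_pushforward q p μ).symm

theorem improvingMaps_comp {f : HVector H Bool} {p q : V → Bool → Bool}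
    (hq : q ∈ improvingMaps (BLP H Bool) f) (hp : p ∈ improvingMaps (BLP H Bool) f) :
    (fun s i => q s (p s i)) ∈ improvingMaps (BLP H Bool) f := by
  refine ⟨hq.1.comp hp.1, fun μ hμ => ?_⟩
  rw [linExt_comp]
  exact (hq.2 _ (pushforward_mem_BLP p hμ)).trans (hp.2 μ hμ)

theorem IsStrictlyImproving.isImproving {L : Type*} [Fintype L] {Λ : Set (HVector H L)}
    {f : HVector H L} {P : HVector H L →ₗ[ℝ] HVector H L} (hP : IsStrictlyImproving Λ f P) :
    IsImproving Λ f P := fun μ hμ => by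
  by_cases h : P μ = μ
  · rw [h]
  · exact (hP μ hμ h).le

theorem strictlyImprovingMaps_comp {f : HVector H Bool} {p q : V → Bool → Bool}
    (hq : q ∈ strictlyImprovingMaps (BLP H Bool) f)
    (hp : p ∈ strictlyImprovingMaps (BLP H Bool) f) :
    (fun s i => q s (p s i)) ∈ strictlyImprovingMaps (BLP H Bool) f := by
  refine ⟨hq.1.comp hp.1, fun μ hμ hne => ?_⟩
  rw [linExt_comp] at hne ⊢
  by_cases h : linExt p μ = μ
  · rw [h] at hne ⊢
    exact hq.2 μ hμ hne
  · exact (hq.2.isImproving _ (pushforward_mem_BLP p hμ)).trans_lt (hp.2 μ hμ h)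

theorem apply_eq_self_of_isMinimizer {L : Type*} [Fintype L] [DecidableEq L] {f : HVector H L}
    {p : V → L → L} (hp : p ∈ strictlyImprovingMaps (BLP H L) f) {x : V → L}
    (hx : IsMinimizer f x) (s : V) : p s (x s) = x s := by
  by_contra hne
  have h1 := hp.2 _ (dirac_mem_BLP x) fun e => hne (by
    rw [linExt_dirac] at e
    exact congrFun (dirac_injective e) s)
  rw [linExt_dirac, scalarProd_dirac, scalarProd_dirac] at h1
  exact (hx _).not_gt h1

/-- At such a node both maps are constants, equal to the label of a common fixed minimizer. -/
theorem eliminated_subset_of_isMaxPersistency [Fintype V] {f : HVector H Bool}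
    {p q : V → Bool → Bool} (hp : p ∈ strictlyImprovingMaps (BLP H Bool) f)
    (hq : IsMaxPersistency (strictlyImprovingMaps (BLP H Bool) f) q) :
    eliminated p ⊆ eliminated q := by
  rintro ⟨s, i⟩ hsi
  simp only [eliminated, Finset.mem_filter, Finset.mem_univ, true_and] at hsi ⊢
  have hqs := hq.ne_id hq.1.1 (strictlyImprovingMaps_comp hq.1 hp) (s := s)
    fun e => hsi (congrFun e i)
  obtain ⟨x, hx⟩ := Finite.exists_min (energy f)
  have key : ∀ (p q : Bool → Bool) (i j : Bool), (∀ i, p (p i) = p i) → (∀ i, q (q i) = q i) →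
      p i ≠ i → q ≠ id → p j = j → q j = j → q i ≠ i := by decide
  exact key _ _ _ _ (hp.1 s) (hq.1.1 s) hsi hqs (apply_eq_self_of_isMinimizer hp hx s)
    (apply_eq_self_of_isMinimizer hq.1 hx s)

end MaxPersistency

end Persistency

theorem mainTheorem8 {V : Type*} [Fintype V] [DecidableEq V]
    (H : Persistency.EnergyHypergraph V)
    (f : Persistency.HVector H Bool) (f' : Persistency.HVector H Persistency.HalfLabel)
    (hf' : Persistency.IsSoBRelaxation f' f)
    (xs : V → Persistency.HalfLabel) (hxs : Persistency.IsMinimizer f' xs) :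
    -- the mapping is BLP-improving
    Persistency.persistencyMap xs ∈
        Persistency.improvingMaps (Persistency.BLP H Bool) f ∧
    -- it is dominated by every solution of the maximum persistency problem, which exists
    (∃ q, Persistency.IsMaxPersistency
        (Persistency.improvingMaps (Persistency.BLP H Bool) f) q) ∧
    (∀ q, Persistency.IsMaxPersistency
        (Persistency.improvingMaps (Persistency.BLP H Bool) f) q →
      (Persistency.eliminated (Persistency.persistencyMap xs)).card ≤
          (Persistency.eliminated q).card ∧
        ∀ s, xs s ≠ Persistency.HalfLabel.half → q s ≠ id) ∧
    -- the strict version, for the strong persistency of the relaxation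
    ((∀ y, Persistency.IsMinimizer f' y → ∀ s, xs s ≠ Persistency.HalfLabel.half → y s = xs s) →
      Persistency.persistencyMap xs ∈
          Persistency.strictlyImprovingMaps (Persistency.BLP H Bool) f ∧
      (∃ q, Persistency.IsMaxPersistency
        (Persistency.strictlyImprovingMaps (Persistency.BLP H Bool) f) q) ∧
      (∀ q, Persistency.IsMaxPersistency
          (Persistency.strictlyImprovingMaps (Persistency.BLP H Bool) f) q →
        Persistency.eliminated (Persistency.persistencyMap xs) ⊆ Persistency.eliminated q)) := by
  refine ⟨Persistency.persistencyMap_mem_improvingMaps hf' hxs,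
    Persistency.exists_isMaxPersistency
      ⟨_, Persistency.persistencyMap_mem_improvingMaps hf' hxs⟩, fun q hq => ⟨?_, fun s hs => ?_⟩,
    fun hstrong => ?_⟩
  · exact hq.2 _ (Persistency.persistencyMap_mem_improvingMaps hf' hxs)
  · exact hq.ne_id hq.1.1 (Persistency.improvingMaps_comp hq.1
      (Persistency.persistencyMap_mem_improvingMaps hf' hxs)) (Persistency.persistencyMap_ne_id hs)
  · have hp := Persistency.persistencyMap_mem_strictlyImprovingMaps hf' hxs hstrong
    exact ⟨hp, Persistency.exists_isMaxPersistency ⟨_, hp⟩,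
      fun q hq => Persistency.eliminated_subset_of_isMaxPersistency hp hq⟩
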